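/- **Setting.** Let $\mathcal S$ be a bounded metric space, $\mathcal A$ a metric space, and $\mathcal C$ an open convex subset of a real Banach space; products of metric spaces carry the maximum metric. Let $\mathrm{Meas}(\mathcal S)$ be the space of finite signed Borel measures on $\mathcal S$ with the total variation norm $\|\mu\|=\mu^+(\mathcal S)+\mu^-(\mathcal S)$, where $\mu=\mu^+-\mu^-$ is the Jordan decomposition. For $p\in[1,\infty]$ let $\mathcal W_p(\mathcal A)$ be the set of Borel probability measures on $\mathcal A$ with the Wasserstein distance $W_p$ (with $W_\infty=\lim_{q\to\infty}W_q$). $L_f$ denotes the best Lipschitz constant of a map $f$, $\|f\|_\infty$ the supremum of $\|f\|$ over the domain of $f$, and $\|f\|_{\mathrm{Lip}}=\max(\|f\|_\infty,L_f)$; $\mathrm{Lip}(\mathcal S\times\mathcal A)$ is the space of bounded Lipschitz functions $\mathcal S\times\mathcal A\to\mathbb R$. Let $\mathcal T:\mathcal S\times\mathcal A\times\mathcal C\to\mathrm{Meas}(\mathcal S)$, $(s,a,c)\mapsto\mathcal T^c(s,a)$, take values in the probability measures, and let $R:\mathcal S\times\mathcal A\times\mathcal C\to\mathbb R$, $(s,a,c)\mapsto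 R^c(s,a)$. Assume that $\mathcal T$ and $R$ are twice continuously differentiable in $c$ for each fixed $(s,a)$; that $\partial_c\mathcal T,\ \partial_c^2\mathcal T,\ R,\ \partial_cR,\ \partial_c^2R$ are bounded; and that $\mathcal T,\ \partial_c\mathcal T,\ R,\ \partial_cR$ are Lipschitz on $\mathcal S\times\mathcal A\times\mathcal C$ (derivatives are measured in operator norm, and $L_{\mathcal T}$ is taken with respect to the total variation norm). Let $\pi:\mathcal S\times\mathcal C\to\mathcal W_p(\mathcal A)$ be Lipschitz with constant $L_\pi$. For $\gamma\in[0,1)$, a reward $r$ and transitions $K$ on $\mathcal S\times\mathcal A$, consider the Bellman equation in context $c$, $$Q(s,a)=r(s,a)+\gamma\int_{\mathcal S}\int_{\mathcal A}Q(s',a')\,d\pi(s',c)(a')\,dK(s,a)(s').$$ **Theorem.** Let $c_0,c\in\mathcal C$ and $\gamma\in[0,1)$ satisfy $$\|c-c_0\|<\|\partial_c^2\mathcal T\|_\infty^{-1/2},\qquad \gamma<\frac{1}{4\,\mathrm{diam}(\mathcal S)\,(L_{\mathcal T}+\|c-c_0\|L_{\partial_c\mathcal T})(1+L_\pi)},$$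 where a right-hand side with vanishing denominator is read as $+\infty$. Put $$\widehat{\mathcal T}(s,a)=\mathcal T^{c_0}(s,a)+\partial_c\mathcal T^{c_0}(s,a)\cdot(c-c_0),\quad \mathcal T^c_{ce}(s,a)=P(\widehat{\mathcal T}(s,a)),\quad R^c_{ce}=R^{c_0}+\partial_cR^{c_0}\cdot(c-c_0),$$ with $P(\mu)=\mu^+/\|\mu^+\|$. Then $\widehat{\mathcal T}(s,a)^+\ne 0$ for all $(s,a)$, so $\mathcal T^c_{ce}$ is well defined; the Bellman equations in context $c$ for $(R^c,\mathcal T^c)$ and for $(R^c_{ce},\mathcal T^c_{ce})$ have unique solutions $Q^c_{be}$ and $Q^c_{ce}$ in $\mathrm{Lip}(\mathcal S\times\mathcal A)$; and $$\|Q^c_{ce}-Q^c_{be}\|_\infty\le\frac{\|c-c_0\|^2}{1-\gamma}\left(\|\partial_c^2R\|_\infty+\frac{3\gamma\,\mathrm{diam}(\mathcal S)(1+L_\pi)\,\|R\|_{\mathrm{Lip}(\mathcal S\times\mathcal A\times\mathcal C)}\,\|\partial_c^2\mathcal T\|_\infty}{1-\gamma\max\big(1,\mathrm{diam}(\mathcal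 S)L_{\mathcal T}(1+L_\pi)\big)}\right).$$ -/

import Mathlib

open MeasureTheory Set
open scoped ENNReal NNReal

noncomputable section

namespace CEBE

/-! ### Finite signed measures with the total variation norm -/

section TotalVariation

variable {X : Type*} [MeasurableSpace X]

/-- The total variation norm `‖μ‖ = |μ|(X) = μ⁺(X) + μ⁻(X)` of a finite signed measure. -/
def tvNorm (μ : SignedMeasure X) : ℝ := μ.totalVariation.real univ

theorem tvNorm_eq (μ : SignedMeasure X) :
    tvNorm μ = μ.toJordanDecomposition.posPart.real univ +
      μ.toJordanDecomposition.negPart.real univ := by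
  rw [tvNorm, SignedMeasure.totalVariation, measureReal_add_apply]

theorem tvNorm_zero : tvNorm (0 : SignedMeasure X) = 0 := by
  simp [tvNorm, SignedMeasure.totalVariation_zero]

theorem tvNorm_neg (μ : SignedMeasure X) : tvNorm (-μ) = tvNorm μ := by
  simp [tvNorm, SignedMeasure.totalVariation_neg]

theorem tvNorm_add_le (μ ν : SignedMeasure X) : tvNorm (μ + ν) ≤ tvNorm μ + tvNorm ν := by
  have h : (μ + ν).totalVariation ≤ μ.totalVariation + ν.totalVariation := by
    simp only [SignedMeasure.totalVariation_eq_variation]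
    exact VectorMeasure.variation_add_le
  rw [tvNorm, tvNorm, tvNorm, ← measureReal_add_apply]
  exact ENNReal.toReal_mono (measure_ne_top _ _) (h univ)

theorem tvNorm_smul (r : ℝ) (μ : SignedMeasure X) : tvNorm (r • μ) = |r| * tvNorm μ := by
  rw [tvNorm_eq, tvNorm_eq, SignedMeasure.toJordanDecomposition_smul_real]
  rcases le_or_gt 0 r with hr | hr
  · rw [JordanDecomposition.real_smul_posPart_nonneg _ _ hr,
      JordanDecomposition.real_smul_negPart_nonneg _ _ hr,
      measureReal_nnreal_smul_apply, measureReal_nnreal_smul_apply,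
      Real.coe_toNNReal _ hr, abs_of_nonneg hr]
    ring
  · rw [JordanDecomposition.real_smul_posPart_neg _ _ hr,
      JordanDecomposition.real_smul_negPart_neg _ _ hr,
      measureReal_nnreal_smul_apply, measureReal_nnreal_smul_apply,
      Real.coe_toNNReal _ (by linarith), abs_of_neg hr]
    ring

theorem eq_zero_of_tvNorm_eq_zero (μ : SignedMeasure X) (h : tvNorm μ = 0) : μ = 0 := by
  ext i _
  have h1 := SignedMeasure.norm_le_totalVariation μ i
  have h2 : μ.totalVariation.real i ≤ μ.totalVariation.real univ :=
    measureReal_mono (subset_univ i)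
  have h3 : ‖μ i‖ ≤ 0 := h1.trans (h2.trans h.le)
  simpa using h3

/-- The finite signed measures on `X`, normed by total variation. -/
instance instNormedAddCommGroupSignedMeasure : NormedAddCommGroup (SignedMeasure X) :=
  AddGroupNorm.toNormedAddCommGroup
    { toFun := tvNorm
      map_zero' := tvNorm_zero
      add_le' := tvNorm_add_le
      neg' := tvNorm_neg
      eq_zero_of_map_eq_zero' := eq_zero_of_tvNorm_eq_zero }

instance instNormedSpaceSignedMeasure : NormedSpace ℝ (SignedMeasure X) where
  norm_smul_le r μ := (tvNorm_smul r μ).le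

/-- The signed measure `μ` is a probability measure. -/
def IsProbability (μ : SignedMeasure X) : Prop := 0 ≤ μ ∧ μ univ = 1

/-- The projection `P(μ) = μ⁺ / ‖μ⁺‖` to the probability simplex. It is meaningful for signed
measures with `μ⁺(X) > 0`. -/
def simplexProj (μ : SignedMeasure X) : SignedMeasure X :=
  (μ.toJordanDecomposition.posPart.real univ)⁻¹ •
    μ.toJordanDecomposition.posPart.toSignedMeasure

end TotalVariation

/-! ### Sup norms, Lipschitz constants, Lipschitz norms -/

section Norms

/-- `f` is bounded on `s`. -/
def IsBoundedOn {X V : Type*} [Norm V] (f : X → V) (s : Set X) : Prop :=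
  ∃ B : ℝ, ∀ x ∈ s, ‖f x‖ ≤ B

/-- The sup norm `‖f‖_∞` over the set `s`. -/
def supNormOn {X V : Type*} [Norm V] (f : X → V) (s : Set X) : ℝ :=
  ⨆ x : s, ‖f x‖

variable {X Y : Type*} [PseudoEMetricSpace X] [PseudoEMetricSpace Y]

/-- `f` is Lipschitz on `s`. -/
def IsLipschitzOn (f : X → Y) (s : Set X) : Prop :=
  ∃ K : ℝ≥0, LipschitzOnWith K f s

/-- The (best) Lipschitz constant `L_f` of `f` on `s`. -/
def lipConstOn (f : X → Y) (s : Set X) : ℝ≥0 :=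
  sInf {K : ℝ≥0 | LipschitzOnWith K f s}

/-- The norm `max (sup |f|, L_f)` of the space of bounded Lipschitz functions on `s`. -/
def lipNormOn (f : X → ℝ) (s : Set X) : ℝ :=
  max (supNormOn f s) (lipConstOn f s)

end Norms

/-! ### Wasserstein distances and Lipschitz policies -/

section Wasserstein

variable {X : Type*} [MetricSpace X] [MeasurableSpace X]

/-- Couplings of `μ` and `ν`: Borel measures on `X × X` with marginals `μ` and `ν`.
The Borel `σ`-algebra of `X × X` makes the distance measurable; it is the product `σ`-algebra
when `X` is separable. -/
def IsCoupling (μ ν : Measure X) (Γ : @Measure (X × X) (borel (X × X))) : Prop :=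
  @Measure.map _ _ (borel (X × X)) _ Prod.fst Γ = μ ∧
    @Measure.map _ _ (borel (X × X)) _ Prod.snd Γ = ν

/-- `W_q(μ, ν) = inf_Γ (∫ d(x, y)^q dΓ)^{1/q}` for real `q ≥ 1`, with values in `[0, ∞]`. -/
def wassersteinReal (q : ℝ) (μ ν : Measure X) : ℝ≥0∞ :=
  ⨅ (Γ : @Measure (X × X) (borel (X × X))) (_ : IsCoupling μ ν Γ),
    (@lintegral _ (borel (X × X)) Γ fun z => edist z.1 z.2 ^ q) ^ (1 / q)

/-- `W_p(μ, ν)` for `p ∈ [1, ∞]`, where `W_∞ = lim_{q → ∞} W_q`; as `q ↦ W_q` is nondecreasing on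
`[1, ∞)` for probability measures, the limit is the supremum. -/
def wasserstein (p : ℝ≥0∞) (μ ν : Measure X) : ℝ≥0∞ :=
  if p = ∞ then ⨆ (q : ℝ) (_ : 1 ≤ q), wassersteinReal q μ ν
  else wassersteinReal p.toReal μ ν

variable {S E : Type*} [PseudoEMetricSpace S] [PseudoEMetricSpace E]

/-- The policy `π : S × C → W_p(X)` is Lipschitz with constant `K`. -/
def PolicyLipschitzWith (p : ℝ≥0∞) (C : Set E) (K : ℝ≥0)
    (π : S × E → ProbabilityMeasure X) : Prop :=
  ∀ (s s' : S), ∀ c ∈ C, ∀ c' ∈ C,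
    wasserstein p (π (s, c) : Measure X) (π (s', c') : Measure X) ≤
      K * edist (s, c) (s', c')

/-- The (best) Lipschitz constant `L_π` of a policy `π : S × C → W_p(X)`. -/
def policyLipConst (p : ℝ≥0∞) (C : Set E) (π : S × E → ProbabilityMeasure X) : ℝ≥0 :=
  sInf {K : ℝ≥0 | PolicyLipschitzWith p C K π}

end Wasserstein

/-! ### Contexts: slices, partial derivatives, linearization -/

section Context

variable {S A E F : Type*}

/-- The set `S × A × C`. -/
def dom (S A : Type*) {E : Type*} (C : Set E) : Set (S × A × E) := {z | z.2.2 ∈ C}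

/-- The slice `f^c : S × A → F`. -/
def slice (f : S × A × E → F) (c : E) : S × A → F := fun z => f (z.1, z.2, c)

variable [NormedAddCommGroup E] [NormedSpace ℝ E] [NormedAddCommGroup F] [NormedSpace ℝ F]

/-- The partial derivative `∂_c f`. The second derivative `∂²_c f` is `partialC (partialC f)`. -/
def partialC (f : S × A × E → F) : S × A × E → (E →L[ℝ] F) :=
  fun z => fderiv ℝ (fun c => f (z.1, z.2.1, c)) z.2.2

/-- The linearization `f^{c₀} + ∂_c f^{c₀} · (c - c₀)`. -/
def linearize (f : S × A × E → F) (c₀ c : E) : S × A → F :=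
  fun z => f (z.1, z.2, c₀) + partialC f (z.1, z.2, c₀) (c - c₀)

/-- `f` is twice continuously differentiable in the context `c ∈ C`. -/
def IsC2InContext (f : S × A × E → F) (C : Set E) : Prop :=
  ∀ (s : S) (a : A), ContDiffOn ℝ 2 (fun c => f (s, a, c)) C

end Context

/-! ### The Bellman equation -/

section Bellman

variable {S A : Type*} [MetricSpace S] [MeasurableSpace S] [MetricSpace A] [MeasurableSpace A]

/-- `(A^{K, π} Q)(s, a) = ∫_S ∫_A Q(s', a') dπ_{s'}(a') dK_{s, a}(s')`. -/
def bellmanOp (K : S × A → SignedMeasure S) (π : S → ProbabilityMeasure A) (Q : S × A → ℝ) :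
    S × A → ℝ :=
  fun z => ∫ᵛ s', (∫ a', Q (s', a') ∂(π s' : Measure A)) ∂<•(K z)

/-- `Q` is a `Q`-function for the reward `r`, the transitions `K`, the policy `π` and the discount
factor `γ`: a bounded Lipschitz solution of the Bellman equation `Q = r + γ A^{K, π} Q`. -/
structure IsQFunction (γ : ℝ) (r : S × A → ℝ) (K : S × A → SignedMeasure S)
    (π : S → ProbabilityMeasure A) (Q : S × A → ℝ) : Prop where
  bounded : IsBoundedOn Q univ
  lipschitz : IsLipschitzOn Q univ
  bellman : ∀ z, Q z = r z + γ * bellmanOp K π Q z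

end Bellman

end CEBE

end

namespace CEBE

/-! ### Total variation, projection to the simplex, integration against signed measures. -/

section TotalVariation

variable {X : Type*} [MeasurableSpace X]

/-! The error bound is a perturbation estimate for Bellman equations. The Bellman operator is a
`γ`-contraction in the sup norm, and replacing its kernel costs the Lipschitz constant of the
solution times `(1 + L_π) diam S` times the total variation error: the difference of two probability
kernels has mass zero, so only the oscillation of the state value counts
(`abs_bellmanOp_sub_le_mul_norm`, `abs_sub_le_of_bellman`).

The data errors are quadratic in `c - c₀` by Taylor (`norm_sub_sub_fderiv_le`). Linearized
transitions keep total mass one, since the derivative of a constant mass vanishes; hence their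
positive part has mass at least one. The projection then multiplies the error by at most 3
(`norm_simplexProj_sub_le`) and Lipschitz constants by at most 2
(`norm_simplexProj_sub_simplexProj_le`).

Existence is Banach's fixed point theorem on a closed set of functions with a common Lipschitz
constant; the bound on `γ` makes this set invariant. -/

theorem norm_signedMeasure_eq (μ : SignedMeasure X) : ‖μ‖ = μ.variation.real univ := by
  rw [← SignedMeasure.totalVariation_eq_variation]; rfl

theorem abs_apply_le_norm (μ : SignedMeasure X) (i : Set X) : |μ i| ≤ ‖μ‖ :=
  (SignedMeasure.norm_le_totalVariation μ i).trans (measureReal_mono (subset_univ i))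

theorem norm_le_of_forall_abs_apply_le (ρ : SignedMeasure X) (τ : Measure X) [IsFiniteMeasure τ]
    (h : ∀ i, MeasurableSet i → |ρ i| ≤ τ.real i) : ‖ρ‖ ≤ τ.real univ := by
  rw [norm_signedMeasure_eq]
  refine ENNReal.toReal_mono (measure_ne_top _ _) ?_
  refine VectorMeasure.variation_le_of_forall_enorm_le (m := τ) (fun i hi => ?_) univ
  rw [← ofReal_norm, Real.norm_eq_abs, ← ofReal_measureReal]
  exact ENNReal.ofReal_le_ofReal (h i hi)

theorem norm_le_apply_univ_of_nonneg (μ : SignedMeasure X) (h : 0 ≤ μ) : ‖μ‖ ≤ μ univ := by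
  have h0 : 0 ≤[univ] μ := (VectorMeasure.le_restrict_univ_iff_le _ _).2 h
  have := norm_le_of_forall_abs_apply_le μ (μ.toMeasureOfZeroLE univ MeasurableSet.univ h0)
    (fun i hi => by
      rw [SignedMeasure.toMeasureOfZeroLE_real_apply _ _ _ hi, univ_inter]
      exact (abs_of_nonneg (h i hi)).le)
  rwa [SignedMeasure.toMeasureOfZeroLE_real_apply _ _ _ MeasurableSet.univ, univ_inter] at this

theorem norm_toSignedMeasure_le (μ : Measure X) [IsFiniteMeasure μ] :
    ‖μ.toSignedMeasure‖ ≤ μ.real univ := by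
  have := norm_le_apply_univ_of_nonneg _ (Measure.zero_le_toSignedMeasure μ)
  rwa [Measure.toSignedMeasure_apply_measurable MeasurableSet.univ] at this

/-- On a Hahn set `P` of `μ` the positive part is `μ (P ∩ i)`, while `ν (P ∩ i)` never exceeds the
positive part of `ν` on `i`. -/
theorem posPart_real_le (μ ν : SignedMeasure X) {i : Set X} (hi : MeasurableSet i) :
    μ.toJordanDecomposition.posPart.real i ≤
      ν.toJordanDecomposition.posPart.real i + (μ - ν).totalVariation.real i := by
  obtain ⟨P, hP, hpos, hneg, hp, hn⟩ := μ.toJordanDecomposition_spec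
  rw [hp, SignedMeasure.toMeasureOfZeroLE_real_apply _ _ _ hi]
  have h1 : μ (P ∩ i) = ν (P ∩ i) + (μ - ν) (P ∩ i) := by
    rw [_root_.sub_apply]; ring
  have h2 : (μ - ν) (P ∩ i) ≤ (μ - ν).totalVariation.real i :=
    (le_abs_self _).trans ((SignedMeasure.norm_le_totalVariation (μ - ν) (P ∩ i)).trans
      (measureReal_mono inter_subset_right))
  have h3 := ν.apply_eq_posPart_real_sub_negPart_real (hP.inter hi)
  have h4 : ν.toJordanDecomposition.posPart.real (P ∩ i) ≤
    ν.toJordanDecomposition.posPart.real i := measureReal_mono inter_subset_right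
  have h5 : 0 ≤ ν.toJordanDecomposition.negPart.real (P ∩ i) := measureReal_nonneg
  linarith

/-- Taking the positive part is a contraction for the total variation norm. -/
theorem norm_posPart_sub_posPart_le (μ ν : SignedMeasure X) :
    ‖μ.toJordanDecomposition.posPart.toSignedMeasure -
      ν.toJordanDecomposition.posPart.toSignedMeasure‖ ≤ ‖μ - ν‖ := by
  refine norm_le_of_forall_abs_apply_le _ (μ - ν).totalVariation fun i hi => ?_
  rw [Measure.toSignedMeasure_sub_apply hi]
  have h1 := posPart_real_le μ ν hi
  have h2 := posPart_real_le ν μ hi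
  rw [← neg_sub μ ν, SignedMeasure.totalVariation_neg] at h2
  exact abs_le.2 ⟨by linarith, by linarith⟩

/-- The negative part has mass `-μ Pᶜ` for a Hahn set `P`, and `ν Pᶜ ≥ 0` can only increase the gap
between the two measures there. -/
theorem negPart_real_univ_le (μ ν : SignedMeasure X) (hν : 0 ≤ ν) :
    μ.toJordanDecomposition.negPart.real univ ≤ ‖μ - ν‖ := by
  obtain ⟨P, hP, hpos, hneg, hp, hn⟩ := μ.toJordanDecomposition_spec
  rw [hn, SignedMeasure.toMeasureOfLEZero_real_apply _ _ _ MeasurableSet.univ, inter_univ]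
  have h1 := abs_apply_le_norm (μ - ν) Pᶜ
  have h2 : 0 ≤ ν Pᶜ := hν _ hP.compl
  rw [_root_.sub_apply] at h1
  linarith [(abs_le.1 h1).1]

theorem posPart_real_univ_eq {μ : SignedMeasure X} (hμ : μ univ = 1) :
    μ.toJordanDecomposition.posPart.real univ =
      1 + μ.toJordanDecomposition.negPart.real univ := by
  have := μ.apply_eq_posPart_real_sub_negPart_real MeasurableSet.univ
  linarith

theorem one_le_posPart_real_univ {μ : SignedMeasure X} (hμ : μ univ = 1) :
    1 ≤ μ.toJordanDecomposition.posPart.real univ := by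
  rw [posPart_real_univ_eq hμ]
  linarith [measureReal_nonneg (μ := μ.toJordanDecomposition.negPart) (s := univ)]

theorem isProbability_simplexProj {μ : SignedMeasure X} (hμ : μ univ = 1) :
    IsProbability (simplexProj μ) := by
  have h1 := one_le_posPart_real_univ hμ
  constructor
  · intro i hi
    rw [simplexProj, _root_.smul_apply, Measure.toSignedMeasure_apply_measurable hi]
    simp only [FunLike.coe_zero, Pi.zero_apply, smul_eq_mul]
    positivity
  · rw [simplexProj, _root_.smul_apply,
      Measure.toSignedMeasure_apply_measurable MeasurableSet.univ, smul_eq_mul,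
      inv_mul_cancel₀ (by linarith)]

/-- With `k` the mass of the negative part, the positive part has mass `1 + k`. Renormalizing it
moves mass `k`, dropping the negative part another `k`, and `k ≤ ‖μ - ν‖`; adding `μ - ν` itself
gives the factor 3. -/
theorem norm_simplexProj_sub_le {μ ν : SignedMeasure X} (hμ : μ univ = 1) (hν : 0 ≤ ν) :
    ‖simplexProj μ - ν‖ ≤ 3 * ‖μ - ν‖ := by
  set j := μ.toJordanDecomposition with hj
  have hm : j.posPart.real univ = 1 + j.negPart.real univ := posPart_real_univ_eq hμ
  have hk0 : 0 ≤ j.negPart.real univ := measureReal_nonneg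
  have hk : j.negPart.real univ ≤ ‖μ - ν‖ := negPart_real_univ_le μ ν hν
  have hdec : simplexProj μ - ν = ((j.posPart.real univ)⁻¹ - 1) • j.posPart.toSignedMeasure +
      j.negPart.toSignedMeasure + (μ - ν) := by
    have : μ = j.posPart.toSignedMeasure - j.negPart.toSignedMeasure :=
      μ.toSignedMeasure_toJordanDecomposition.symm
    have hP : simplexProj μ = (j.posPart.real univ)⁻¹ • j.posPart.toSignedMeasure := rfl
    rw [hP, sub_smul, one_smul]
    clear_value j
    rw [this]
    abel
  have h1 : ‖((j.posPart.real univ)⁻¹ - 1) • j.posPart.toSignedMeasure‖ ≤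
      j.negPart.real univ := by
    rw [norm_smul, Real.norm_eq_abs, abs_of_nonpos (by
      rw [sub_nonpos]; exact inv_le_one_of_one_le₀ (by linarith))]
    calc _ ≤ -((j.posPart.real univ)⁻¹ - 1) * j.posPart.real univ := by
          gcongr
          · rw [neg_sub, sub_nonneg]; exact inv_le_one_of_one_le₀ (by linarith)
          · exact norm_toSignedMeasure_le _
      _ = _ := by
          rw [neg_sub, sub_mul, inv_mul_cancel₀ (by linarith)]; linarith
  have h2 := norm_toSignedMeasure_le j.negPart
  rw [hdec]
  refine (norm_add₃_le).trans ?_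
  linarith

/-- Both normalizing masses are at least one, so division expands nothing. One `‖μ - ν‖` comes from
the positive parts, the other from their masses. -/
theorem norm_simplexProj_sub_simplexProj_le {μ ν : SignedMeasure X} (hμ : μ univ = 1)
    (hν : ν univ = 1) : ‖simplexProj μ - simplexProj ν‖ ≤ 2 * ‖μ - ν‖ := by
  have hm := one_le_posPart_real_univ hμ
  have hn := one_le_posPart_real_univ hν
  have hpn := norm_posPart_sub_posPart_le μ ν
  rw [simplexProj, simplexProj]
  set p := μ.toJordanDecomposition.posPart
  set q := ν.toJordanDecomposition.posPart
  have hd : |p.real univ - q.real univ| ≤ ‖μ - ν‖ := by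
    rw [← Measure.toSignedMeasure_sub_apply MeasurableSet.univ]
    exact (abs_apply_le_norm _ _).trans hpn
  have hdec : (p.real univ)⁻¹ • p.toSignedMeasure - (q.real univ)⁻¹ • q.toSignedMeasure =
      (p.real univ)⁻¹ • (p.toSignedMeasure - q.toSignedMeasure) +
        ((p.real univ)⁻¹ - (q.real univ)⁻¹) • q.toSignedMeasure := by
    rw [smul_sub, sub_smul]; abel
  have h1 : ‖(p.real univ)⁻¹ • (p.toSignedMeasure - q.toSignedMeasure)‖ ≤ ‖μ - ν‖ := by
    rw [norm_smul, Real.norm_eq_abs, abs_of_nonneg (by positivity)]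
    calc _ ≤ 1 * ‖p.toSignedMeasure - q.toSignedMeasure‖ := by
          gcongr; exact inv_le_one_of_one_le₀ hm
      _ ≤ _ := by rwa [one_mul]
  have h2 : ‖((p.real univ)⁻¹ - (q.real univ)⁻¹) • q.toSignedMeasure‖ ≤ ‖μ - ν‖ := by
    rw [norm_smul, Real.norm_eq_abs]
    calc _ ≤ |(p.real univ)⁻¹ - (q.real univ)⁻¹| * q.real univ := by
          gcongr; exact norm_toSignedMeasure_le _
      _ = (p.real univ)⁻¹ * |p.real univ - q.real univ| := by
          have hp0 : (0 : ℝ) < p.real univ := by linarith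
          have hq0 : (0 : ℝ) < q.real univ := by linarith
          rw [inv_sub_inv hp0.ne' hq0.ne', abs_div, abs_of_pos (mul_pos hp0 hq0), abs_sub_comm]
          field_simp
      _ ≤ 1 * |p.real univ - q.real univ| := by
          gcongr; exact inv_le_one_of_one_le₀ hm
      _ ≤ _ := by rwa [one_mul]
  rw [hdec]
  refine (norm_add_le _ _).trans ?_
  linarith

instance isFiniteMeasure_variation (μ : SignedMeasure X) : IsFiniteMeasure μ.variation := by
  rw [← SignedMeasure.totalVariation_eq_variation]; infer_instance

theorem integrable_of_measurable_of_abs_le (μ : SignedMeasure X) {f : X → ℝ} (hf : Measurable f)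
    {B : ℝ} (hB : ∀ x, |f x| ≤ B) : μ.Integrable f :=
  Integrable.of_bound hf.aestronglyMeasurable B (Filter.Eventually.of_forall hB)

theorem abs_integral_le_mul_norm (μ : SignedMeasure X) {f : X → ℝ} {B : ℝ}
    (hB : ∀ x, |f x| ≤ B) : |∫ᵛ x, f x ∂<•μ| ≤ B * ‖μ‖ := by
  -- On an empty space `B` may be negative, but then `μ = 0`.
  rcases isEmpty_or_nonempty X with hX | ⟨⟨x₀⟩⟩
  · have : μ = 0 := by ext i hi; simp [Set.eq_empty_of_isEmpty i]
    subst this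
    simp
  have hB0 : 0 ≤ B := (abs_nonneg _).trans (hB x₀)
  have h := VectorMeasure.norm_integral_le_of_norm_le_const (μ := μ)
    (B := (ContinuousLinearMap.lsmul ℝ ℝ : ℝ →L[ℝ] ℝ →L[ℝ] ℝ).flip)
    (f := f) (C := B) (Filter.Eventually.of_forall hB)
  rw [norm_signedMeasure_eq]
  refine h.trans ?_
  gcongr
  have : ‖(ContinuousLinearMap.lsmul ℝ ℝ : ℝ →L[ℝ] ℝ →L[ℝ] ℝ).flip‖ ≤ 1 := by
    rw [ContinuousLinearMap.opNorm_flip]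
    exact ContinuousLinearMap.opNorm_lsmul_le
  nlinarith

/-- A signed measure of total mass zero integrates `f` to at most its norm times the oscillation
of `f`. -/
theorem abs_integral_le_of_apply_univ_eq_zero (μ : SignedMeasure X) (hμ : μ univ = 0) {f : X → ℝ}
    (hf : Measurable f) {B : ℝ} (hB : ∀ x y, |f x - f y| ≤ B) :
    |∫ᵛ x, f x ∂<•μ| ≤ B * ‖μ‖ := by
  rcases isEmpty_or_nonempty X with hX | ⟨⟨x₀⟩⟩
  · exact abs_integral_le_mul_norm μ fun x => hX.elim x
  -- Subtracting the constant `f x₀` does not change the integral against a measure of mass zero,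
  -- and leaves a function bounded by the oscillation.
  have h1 : μ.Integrable fun x => f x - f x₀ :=
    integrable_of_measurable_of_abs_le μ (hf.sub_const _) fun x => hB x x₀
  have h2 : μ.Integrable fun _ => f x₀ := integrable_const _
  have h3 := VectorMeasure.integral_fun_add (μ := μ)
    (B := (ContinuousLinearMap.lsmul ℝ ℝ : ℝ →L[ℝ] ℝ →L[ℝ] ℝ).flip) h1 h2
  simp only [sub_add_cancel] at h3
  rw [h3, VectorMeasure.integral_const, hμ]
  simpa using abs_integral_le_mul_norm μ (fun x => hB x x₀)

end TotalVariation

/-! ### Best constants and suprema as attained bounds. -/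

section Norms

/-- Makes the infimum of admissible Lipschitz constants admissible. Nonemptiness matters, since
`sInf ∅ = 0` in `ℝ≥0`. -/
theorem le_sInf_mul_of_forall_le_mul {s : Set ℝ≥0} (hs : s.Nonempty) {a b : ℝ} (hb : 0 ≤ b)
    (h : ∀ K ∈ s, a ≤ K * b) : a ≤ (sInf s : ℝ≥0) * b := by
  rcases hb.eq_or_lt with rfl | hb
  · obtain ⟨K, hK⟩ := hs
    simpa using h K hK
  · rw [← div_le_iff₀ hb]
    have : (a / b).toNNReal ≤ sInf s := le_csInf hs fun K hK => by
      rw [Real.toNNReal_le_iff_le_coe, div_le_iff₀ hb]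
      exact h K hK
    rwa [Real.toNNReal_le_iff_le_coe] at this

theorem IsLipschitzOn.dist_le_lipConstOn_mul {X Y : Type*} [PseudoMetricSpace X]
    [PseudoMetricSpace Y] {f : X → Y} {s : Set X} (h : IsLipschitzOn f s) {x y : X} (hx : x ∈ s)
    (hy : y ∈ s) : dist (f x) (f y) ≤ lipConstOn f s * dist x y :=
  le_sInf_mul_of_forall_le_mul h dist_nonneg fun _ hK =>
    LipschitzOnWith.dist_le_mul hK x hx y hy

theorem lipConstOn_le_of_dist_le_mul {X Y : Type*} [PseudoMetricSpace X]
    [PseudoMetricSpace Y] {f : X → Y} {s : Set X} {K : ℝ} (hK : 0 ≤ K)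
    (h : ∀ x ∈ s, ∀ y ∈ s, dist (f x) (f y) ≤ K * dist x y) : (lipConstOn f s : ℝ) ≤ K := by
  have : lipConstOn f s ≤ K.toNNReal := csInf_le (OrderBot.bddBelow _)
    (LipschitzOnWith.of_dist_le_mul fun x hx y hy => by
      rw [Real.coe_toNNReal _ hK]; exact h x hx y hy)
  rw [← Real.coe_toNNReal _ hK]
  exact_mod_cast this

theorem IsBoundedOn.norm_le_supNormOn {X V : Type*} [Norm V] {f : X → V} {s : Set X}
    (h : IsBoundedOn f s) {x : X} (hx : x ∈ s) : ‖f x‖ ≤ supNormOn f s := by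
  obtain ⟨B, hB⟩ := h
  exact le_ciSup (f := fun x : s => ‖f x‖) ⟨B, by rintro _ ⟨y, rfl⟩; exact hB y y.2⟩ ⟨x, hx⟩

theorem supNormOn_nonneg {X V : Type*} [SeminormedAddGroup V] (f : X → V) (s : Set X) :
    0 ≤ supNormOn f s :=
  Real.iSup_nonneg fun _ => norm_nonneg _

end Norms

/-! ### Wasserstein distances and the easy half of Kantorovich duality. -/

section Wasserstein

variable {X : Type*} [MetricSpace X] [MeasurableSpace X] [BorelSpace X]

theorem IsCoupling.isProbabilityMeasure {μ ν : Measure X} [IsProbabilityMeasure μ]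
    {Γ : @Measure (X × X) (borel (X × X))} (h : IsCoupling μ ν Γ) :
    @IsProbabilityMeasure _ (borel (X × X)) Γ := by
  -- Overrides the product σ-algebra, so that continuous maps on `X × X` are measurable without
  -- separability.
  let : MeasurableSpace (X × X) := borel (X × X)
  have : BorelSpace (X × X) := ⟨rfl⟩
  have hf : Measurable (Prod.fst : X × X → X) := continuous_fst.measurable
  constructor
  have h1 : Γ.map Prod.fst univ = 1 := by
    rw [show Γ.map Prod.fst = μ from h.1]; exact measure_univ
  rwa [Measure.map_apply hf MeasurableSet.univ, preimage_univ] at h1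

/-- Each coupling is a probability measure, so the `L^q` norm of the distance is nondecreasing in
`q`. -/
theorem wassersteinReal_one_le {q : ℝ} (hq : 1 ≤ q) (μ ν : Measure X) [IsProbabilityMeasure μ] :
    wassersteinReal 1 μ ν ≤ wassersteinReal q μ ν := by
  let : MeasurableSpace (X × X) := borel (X × X)
  have : BorelSpace (X × X) := ⟨rfl⟩
  refine le_iInf fun Γ => le_iInf fun hΓ => ?_
  have : IsProbabilityMeasure Γ := hΓ.isProbabilityMeasure
  refine (iInf₂_le Γ hΓ).trans ?_
  have hm : AEMeasurable (fun z : X × X => edist z.1 z.2) Γ :=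
    (continuous_fst.edist continuous_snd).measurable.aemeasurable
  have h2 : eLpNorm' (fun z : X × X => edist z.1 z.2) 1 Γ ≤
      eLpNorm' (fun z : X × X => edist z.1 z.2) q Γ :=
    eLpNorm'_le_eLpNorm'_of_exponent_le zero_lt_one hq Γ hm.aestronglyMeasurable
  simpa [eLpNorm'] using h2

/-- Reduces every `p` to `W₁`, the only distance the Bellman estimates need. -/
theorem wassersteinReal_one_le_wasserstein {p : ℝ≥0∞} (hp : 1 ≤ p) (μ ν : Measure X)
    [IsProbabilityMeasure μ] : wassersteinReal 1 μ ν ≤ wasserstein p μ ν := by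
  rw [wasserstein]
  split_ifs with h
  · exact le_iSup₂_of_le 1 le_rfl le_rfl
  · exact wassersteinReal_one_le (by simpa using ENNReal.toReal_mono h hp) μ ν

/-- The easy half of Kantorovich duality, for a pair of functions. -/
theorem integral_sub_integral_le_of_wassersteinReal_le {μ ν : Measure X} [IsProbabilityMeasure μ]
    [IsProbabilityMeasure ν] {f g : X → ℝ} (hf : Continuous f) (hg : Continuous g)
    {B : ℝ} (hfB : ∀ x, |f x| ≤ B) (hgB : ∀ x, |g x| ≤ B) {δ L w : ℝ} (hL : 0 ≤ L) (hw : 0 ≤ w)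
    (h : ∀ x y, f x - g y ≤ δ + L * dist x y)
    (hW : wassersteinReal 1 μ ν ≤ ENNReal.ofReal w) :
    ∫ x, f x ∂μ - ∫ x, g x ∂ν ≤ δ + L * w := by
  let : MeasurableSpace (X × X) := borel (X × X)
  have : BorelSpace (X × X) := ⟨rfl⟩
  have hfst : Measurable (Prod.fst : X × X → X) := continuous_fst.measurable
  have hsnd : Measurable (Prod.snd : X × X → X) := continuous_snd.measurable
  -- No optimal coupling is assumed to exist; one of cost below `w + ε` suffices.
  have key : ∀ ε : ℝ, 0 < ε → ∫ x, f x ∂μ - ∫ x, g x ∂ν ≤ δ + L * (w + ε) := by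
    intro ε hε
    have hlt : wassersteinReal 1 μ ν < ENNReal.ofReal (w + ε) :=
      hW.trans_lt ((ENNReal.ofReal_lt_ofReal_iff (by linarith)).2 (by linarith))
    rw [wassersteinReal] at hlt
    obtain ⟨Γ, hΓ⟩ := iInf_lt_iff.1 hlt
    obtain ⟨hΓ, hlt⟩ := iInf_lt_iff.1 hΓ
    have : IsProbabilityMeasure Γ := hΓ.isProbabilityMeasure
    simp only [ENNReal.rpow_one, div_one] at hlt
    have hdm : Measurable fun z : X × X => dist z.1 z.2 :=
      (continuous_fst.dist continuous_snd).measurable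
    have hdist : ∫⁻ z, edist z.1 z.2 ∂Γ = ∫⁻ z, ENNReal.ofReal (dist z.1 z.2) ∂Γ := by
      simp only [edist_dist]
    have hint : Integrable (fun z : X × X => dist z.1 z.2) Γ := by
      refine ⟨hdm.aestronglyMeasurable, ?_⟩
      rw [hasFiniteIntegral_iff_ofReal (Filter.Eventually.of_forall fun z => dist_nonneg),
        ← hdist]
      exact hlt.trans ENNReal.ofReal_lt_top
    have hval : ∫ z, dist z.1 z.2 ∂Γ ≤ w + ε := by
      rw [integral_eq_lintegral_of_nonneg_ae (Filter.Eventually.of_forall fun z => dist_nonneg)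
        hdm.aestronglyMeasurable, ← hdist]
      exact ENNReal.toReal_le_of_le_ofReal (by linarith) hlt.le
    have hF : Integrable (fun z : X × X => f z.1) Γ :=
      Integrable.of_bound (hf.comp continuous_fst).measurable.aestronglyMeasurable B
        (Filter.Eventually.of_forall fun z => hfB _)
    have hG : Integrable (fun z : X × X => g z.2) Γ :=
      Integrable.of_bound (hg.comp continuous_snd).measurable.aestronglyMeasurable B
        (Filter.Eventually.of_forall fun z => hgB _)
    have e1 : ∫ x, f x ∂μ = ∫ z, f z.1 ∂Γ := by
      rw [← show Γ.map Prod.fst = μ from hΓ.1]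
      exact integral_map hfst.aemeasurable hf.measurable.aestronglyMeasurable
    have e2 : ∫ x, g x ∂ν = ∫ z, g z.2 ∂Γ := by
      rw [← show Γ.map Prod.snd = ν from hΓ.2]
      exact integral_map hsnd.aemeasurable hg.measurable.aestronglyMeasurable
    rw [e1, e2, ← integral_sub hF hG]
    calc ∫ z, (f z.1 - g z.2) ∂Γ ≤ ∫ z, (δ + L * dist z.1 z.2) ∂Γ :=
          integral_mono (hF.sub hG) ((integrable_const _).add (hint.const_mul _))
            fun z => h z.1 z.2
      _ = δ + L * ∫ z, dist z.1 z.2 ∂Γ := by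
          rw [integral_add (integrable_const _) (hint.const_mul _), integral_const_mul]
          simp
      _ ≤ δ + L * (w + ε) := by gcongr
  refine le_of_forall_pos_le_add fun ε hε => ?_
  have := key (ε / (L + 1)) (by positivity)
  have h2 : L * (ε / (L + 1)) ≤ ε := by
    rw [mul_div_assoc', div_le_iff₀ (by positivity)]; nlinarith
  linarith [mul_add L w (ε / (L + 1))]

theorem wassersteinReal_one_le_policyLipConst_mul {S E : Type*} [PseudoMetricSpace S]
    [PseudoMetricSpace E] {p : ℝ≥0∞} (hp : 1 ≤ p) {C : Set E} {π : S × E → ProbabilityMeasure X}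
    (hπ : ∃ K : ℝ≥0, PolicyLipschitzWith p C K π) {c : E} (hc : c ∈ C) (s s' : S) :
    wassersteinReal 1 (π (s, c) : Measure X) (π (s', c) : Measure X) ≤
      ENNReal.ofReal (policyLipConst p C π * dist s s') := by
  have h : ∀ K : ℝ≥0, PolicyLipschitzWith p C K π →
      wassersteinReal 1 (π (s, c) : Measure X) (π (s', c) : Measure X) ≤
        ENNReal.ofReal (K * dist s s') := fun K hK => by
    refine (wassersteinReal_one_le_wasserstein hp _ _).trans ((hK s s' c hc c hc).trans_eq ?_)
    rw [edist_dist, Prod.dist_eq, ENNReal.ofReal_mul (NNReal.coe_nonneg K), ENNReal.ofReal_coe_nnreal]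
    simp
  obtain ⟨K₀, hK₀⟩ := hπ
  -- Some admissible constant exists, so the distance is finite and the passage to the infimum can
  -- be made in `ℝ`.
  have hfin := ne_top_of_le_ne_top ENNReal.ofReal_ne_top (h K₀ hK₀)
  rw [← ENNReal.ofReal_toReal hfin]
  refine ENNReal.ofReal_le_ofReal ?_
  refine le_sInf_mul_of_forall_le_mul ⟨K₀, hK₀⟩ dist_nonneg fun K hK => ?_
  exact ENNReal.toReal_le_of_le_ofReal (by positivity) (h K hK)

end Wasserstein

/-! ### Bellman operator: contraction, Lipschitz bounds, existence and stability. -/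

section Bellman

theorem continuous_of_abs_sub_le_mul_dist {X : Type*} [PseudoMetricSpace X] {f : X → ℝ} {L : ℝ}
    (h : ∀ x y, |f x - f y| ≤ L * dist x y) : Continuous f :=
  (LipschitzWith.of_dist_le' h).continuous

theorem norm_le_one_of_isProbability {X : Type*} [MeasurableSpace X] {μ : SignedMeasure X}
    (h : IsProbability μ) : ‖μ‖ ≤ 1 :=
  h.2 ▸ norm_le_apply_univ_of_nonneg μ h.1

variable {S A : Type*} [MeasurableSpace A]

/-- The state value function `s ↦ ∫ Q(s, a) dπ_s(a)` of the policy `π`. -/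
noncomputable def stateValue (π : S → ProbabilityMeasure A) (Q : S × A → ℝ) (s : S) : ℝ :=
  ∫ a, Q (s, a) ∂(π s : Measure A)

theorem abs_stateValue_le {π : S → ProbabilityMeasure A} {Q : S × A → ℝ} {B : ℝ}
    (hB : ∀ z, |Q z| ≤ B) (s : S) : |stateValue π Q s| ≤ B := by
  simpa [stateValue] using norm_integral_le_of_norm_le_const (μ := (π s : Measure A))
    (f := fun a => Q (s, a)) (Filter.Eventually.of_forall fun a => hB (s, a))

variable [MeasurableSpace S]

theorem bellmanOp_eq (K : S × A → SignedMeasure S) (π : S → ProbabilityMeasure A)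
    (Q : S × A → ℝ) (z : S × A) :
    bellmanOp K π Q z = ∫ᵛ s', stateValue π Q s' ∂<•(K z) := rfl

theorem abs_bellmanOp_le {K : S × A → SignedMeasure S} (hK : ∀ z, IsProbability (K z))
    {π : S → ProbabilityMeasure A} {Q : S × A → ℝ} {B : ℝ} (hB : ∀ z, |Q z| ≤ B) (z : S × A) :
    |bellmanOp K π Q z| ≤ B := by
  rw [bellmanOp_eq]
  refine (abs_integral_le_mul_norm _ (abs_stateValue_le hB)).trans ?_
  exact mul_le_of_le_one_right ((abs_nonneg _).trans (hB z)) (norm_le_one_of_isProbability (hK z))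

variable [MetricSpace S] [MetricSpace A] [BorelSpace A]

theorem abs_stateValue_sub_le {π : S → ProbabilityMeasure A} {Q Q' : S × A → ℝ} {B B' N : ℝ}
    (hQ : Continuous Q) (hQ' : Continuous Q') (hB : ∀ z, |Q z| ≤ B) (hB' : ∀ z, |Q' z| ≤ B')
    (hN : ∀ z, |Q z - Q' z| ≤ N) (s : S) :
    |stateValue π Q s - stateValue π Q' s| ≤ N := by
  have h1 : Integrable (fun a => Q (s, a)) (π s : Measure A) :=
    Integrable.of_bound (by fun_prop : Continuous fun a => Q (s, a)).measurable.aestronglyMeasurable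
      B (Filter.Eventually.of_forall fun a => hB _)
  have h2 : Integrable (fun a => Q' (s, a)) (π s : Measure A) :=
    Integrable.of_bound
      (by fun_prop : Continuous fun a => Q' (s, a)).measurable.aestronglyMeasurable
      B' (Filter.Eventually.of_forall fun a => hB' _)
  rw [stateValue, stateValue, ← integral_sub h1 h2]
  simpa using norm_integral_le_of_norm_le_const (μ := (π s : Measure A))
    (f := fun a => Q (s, a) - Q' (s, a)) (Filter.Eventually.of_forall fun a => hN (s, a))

/-- Source of the factor `1 + L_π`: moving the state inside `Q` costs `L`, transporting `π s` to `π
s'` costs `L * Λ`. Duality for a pair of functions handles both at once. -/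
theorem abs_stateValue_sub_le_mul_dist {π : S → ProbabilityMeasure A} {Λ : ℝ} (hΛ : 0 ≤ Λ)
    (hπ : ∀ s s', wassersteinReal 1 (π s : Measure A) (π s') ≤ ENNReal.ofReal (Λ * dist s s'))
    {Q : S × A → ℝ} {B L : ℝ} (hL : 0 ≤ L) (hB : ∀ z, |Q z| ≤ B)
    (hQ : ∀ z z', |Q z - Q z'| ≤ L * dist z z') (s s' : S) :
    |stateValue π Q s - stateValue π Q s'| ≤ L * (1 + Λ) * dist s s' := by
  have hc := continuous_of_abs_sub_le_mul_dist hQ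
  have key : ∀ s s', stateValue π Q s - stateValue π Q s' ≤ L * (1 + Λ) * dist s s' := by
    intro s s'
    have := integral_sub_integral_le_of_wassersteinReal_le (μ := (π s : Measure A))
      (ν := (π s' : Measure A)) (f := fun a => Q (s, a)) (g := fun a => Q (s', a))
      (by fun_prop) (by fun_prop) (fun a => hB _) (fun a => hB _) (δ := L * dist s s') hL
      (by positivity) (fun a b => ?_) (hπ s s')
    · rw [stateValue, stateValue]; linarith
    · refine (le_abs_self _).trans ((hQ _ _).trans ?_)
      rw [← mul_add]
      gcongr
      rw [Prod.dist_eq]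
      exact max_le (by simp) (by simp)
  rw [abs_le]
  have h1 := key s s'
  have h2 := key s' s
  rw [dist_comm s' s] at h2
  exact ⟨by linarith, by linarith⟩

section LipschitzPolicy

variable [BorelSpace S]

variable {π : S → ProbabilityMeasure A} {Λ : ℝ} (hΛ : 0 ≤ Λ)
  (hπ : ∀ s s', wassersteinReal 1 (π s : Measure A) (π s') ≤ ENNReal.ofReal (Λ * dist s s'))

include hΛ hπ

theorem measurable_stateValue {Q : S × A → ℝ} {B L : ℝ} (hL : 0 ≤ L) (hB : ∀ z, |Q z| ≤ B)
    (hQ : ∀ z z', |Q z - Q z'| ≤ L * dist z z') : Measurable (stateValue π Q) :=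
  (continuous_of_abs_sub_le_mul_dist
    (abs_stateValue_sub_le_mul_dist hΛ hπ hL hB hQ)).measurable

/-- Averaging against probability measures is nonexpansive. The Lipschitz bounds on `Q` and `Q'`
provide measurability of the state values. -/
theorem abs_bellmanOp_sub_le {K : S × A → SignedMeasure S} (hK : ∀ z, IsProbability (K z))
    {Q Q' : S × A → ℝ} {B B' L L' N : ℝ} (hL : 0 ≤ L) (hL' : 0 ≤ L') (hB : ∀ z, |Q z| ≤ B)
    (hB' : ∀ z, |Q' z| ≤ B') (hQ : ∀ z z', |Q z - Q z'| ≤ L * dist z z')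
    (hQ' : ∀ z z', |Q' z - Q' z'| ≤ L' * dist z z')
    (hN : ∀ z, |Q z - Q' z| ≤ N) (z : S × A) :
    |bellmanOp K π Q z - bellmanOp K π Q' z| ≤ N := by
  rw [bellmanOp_eq, bellmanOp_eq, ← VectorMeasure.integral_fun_sub
    (integrable_of_measurable_of_abs_le _ (measurable_stateValue hΛ hπ hL hB hQ)
      (abs_stateValue_le hB))
    (integrable_of_measurable_of_abs_le _ (measurable_stateValue hΛ hπ hL' hB' hQ')
      (abs_stateValue_le hB'))]
  refine (abs_integral_le_mul_norm _ (abs_stateValue_sub_le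
    (continuous_of_abs_sub_le_mul_dist hQ) (continuous_of_abs_sub_le_mul_dist hQ')
    hB hB' hN)).trans ?_
  exact mul_le_of_le_one_right ((abs_nonneg _).trans (hN z)) (norm_le_one_of_isProbability (hK z))

variable [BoundedSpace S]

/-- `K z - K' z'` has mass zero, so only the oscillation of the state value enters. Letting both
kernel and point vary serves the Lipschitz estimates and the perturbation estimate alike. -/
theorem abs_bellmanOp_sub_le_mul_norm {K K' : S × A → SignedMeasure S} {z z' : S × A}
    (hK : IsProbability (K z)) (hK' : IsProbability (K' z')) {Q : S × A → ℝ} {B L : ℝ}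
    (hL : 0 ≤ L) (hB : ∀ z, |Q z| ≤ B) (hQ : ∀ z z', |Q z - Q z'| ≤ L * dist z z') :
    |bellmanOp K π Q z - bellmanOp K' π Q z'| ≤
      L * (1 + Λ) * Metric.diam (univ : Set S) * ‖K z - K' z'‖ := by
  have hm := measurable_stateValue hΛ hπ hL hB hQ
  rw [bellmanOp_eq, bellmanOp_eq, ← VectorMeasure.integral_sub_vectorMeasure
    (integrable_of_measurable_of_abs_le _ hm (abs_stateValue_le hB))
    (integrable_of_measurable_of_abs_le _ hm (abs_stateValue_le hB))]
  refine abs_integral_le_of_apply_univ_eq_zero _ ?_ hm fun s s' => ?_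
  · rw [_root_.sub_apply, hK.2, hK'.2, sub_self]
  · refine (abs_stateValue_sub_le_mul_dist hΛ hπ hL hB hQ s s').trans ?_
    gcongr
    exact Metric.dist_le_diam_of_mem (BoundedSpace.bounded_univ) (mem_univ s) (mem_univ s')

/-- Stability of solutions of the Bellman equation under perturbations of the reward and of the
transitions. -/
theorem abs_sub_le_of_bellman {γ : ℝ} (hγ₀ : 0 ≤ γ) (hγ₁ : γ < 1) {r r' : S × A → ℝ}
    {K K' : S × A → SignedMeasure S} (hK : ∀ z, IsProbability (K z))
    (hK' : ∀ z, IsProbability (K' z)) {Q Q' : S × A → ℝ} {B B' L L' : ℝ} (hL : 0 ≤ L)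
    (hL' : 0 ≤ L') (hB : ∀ z, |Q z| ≤ B) (hB' : ∀ z, |Q' z| ≤ B')
    (hQ : ∀ z z', |Q z - Q z'| ≤ L * dist z z') (hQ' : ∀ z z', |Q' z - Q' z'| ≤ L' * dist z z')
    (hb : ∀ z, Q z = r z + γ * bellmanOp K π Q z)
    (hb' : ∀ z, Q' z = r' z + γ * bellmanOp K' π Q' z) {δ ε : ℝ}
    (hr : ∀ z, |r z - r' z| ≤ δ) (hKK' : ∀ z, ‖K z - K' z‖ ≤ ε) (z : S × A) :
    |Q z - Q' z| ≤
      (δ + γ * (L' * (1 + Λ) * Metric.diam (univ : Set S) * ε)) / (1 - γ) := by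
  set η := L' * (1 + Λ) * Metric.diam (univ : Set S) * ε with hη
  have hbd : BddAbove (range fun z => |Q z - Q' z|) := by
    refine ⟨B + B', ?_⟩
    rintro _ ⟨z, rfl⟩
    exact (abs_sub _ _).trans (add_le_add (hB z) (hB' z))
  set N := ⨆ z, |Q z - Q' z| with hN
  have hle : ∀ z, |Q z - Q' z| ≤ N := fun z => le_ciSup hbd z
  -- Inserting `bellmanOp K π Q'` puts the change of kernel on `Q'`, so only the Lipschitz constant
  -- of `Q'` enters the bound.
  have hstep : ∀ z, |Q z - Q' z| ≤ δ + γ * (N + η) := by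
    intro z
    have h1 : |bellmanOp K π Q z - bellmanOp K π Q' z| ≤ N :=
      abs_bellmanOp_sub_le hΛ hπ hK hL hL' hB hB' hQ hQ' hle z
    have h2 : |bellmanOp K π Q' z - bellmanOp K' π Q' z| ≤ η := by
      refine (abs_bellmanOp_sub_le_mul_norm hΛ hπ (hK z) (hK' z) hL' hB' hQ').trans ?_
      rw [hη]
      have := Metric.diam_nonneg (s := (univ : Set S))
      gcongr
      exact hKK' z
    rw [hb z, hb' z]
    calc _ = |(r z - r' z) + γ * ((bellmanOp K π Q z - bellmanOp K π Q' z) +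
            (bellmanOp K π Q' z - bellmanOp K' π Q' z))| := by congr 1; ring
      _ ≤ |r z - r' z| + γ * (|bellmanOp K π Q z - bellmanOp K π Q' z| +
            |bellmanOp K π Q' z - bellmanOp K' π Q' z|) := by
          refine (abs_add_le _ _).trans ?_
          rw [abs_mul, abs_of_nonneg hγ₀]
          gcongr
          exact abs_add_le _ _
      _ ≤ _ := by gcongr; exact hr z
  have hne : Nonempty (S × A) := ⟨z⟩
  have hNle : N ≤ δ + γ * (N + η) := ciSup_le hstep
  refine (hle z).trans ?_
  rw [le_div_iff₀ (by linarith)]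
  linarith

/-- A priori Lipschitz bound for the solution of a Bellman equation. -/
theorem IsQFunction.abs_sub_le {γ : ℝ} (hγ₀ : 0 ≤ γ) {r : S × A → ℝ}
    {K : S × A → SignedMeasure S} (hK : ∀ z, IsProbability (K z)) {Lr LK : ℝ} (hLr : 0 ≤ Lr)
    (hLK : 0 ≤ LK) (hr : ∀ z z', |r z - r z'| ≤ Lr * dist z z')
    (hKl : ∀ z z', ‖K z - K z'‖ ≤ LK * dist z z')
    (hκ : γ * (Metric.diam (univ : Set S) * LK * (1 + Λ)) < 1) {Q : S × A → ℝ}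
    (hQ : IsQFunction γ r K π Q) (z z' : S × A) :
    |Q z - Q z'| ≤
      Lr / (1 - γ * (Metric.diam (univ : Set S) * LK * (1 + Λ))) * dist z z' := by
  obtain ⟨B, hB⟩ := hQ.bounded
  replace hB : ∀ z, |Q z| ≤ B := fun z => hB z (mem_univ z)
  set D := Metric.diam (univ : Set S)
  have hD : 0 ≤ D := Metric.diam_nonneg
  set L : ℝ := (lipConstOn Q univ : ℝ)
  have hL : 0 ≤ L := NNReal.coe_nonneg _
  have hQL : ∀ z z', |Q z - Q z'| ≤ L * dist z z' := fun z z' =>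
    hQ.lipschitz.dist_le_lipConstOn_mul (mem_univ z) (mem_univ z')
  -- The Bellman equation improves the best Lipschitz constant of its own solution; as that constant
  -- is finite, the inequality can be solved for it.
  have hstep : L ≤ Lr + γ * (D * LK * (1 + Λ)) * L := by
    refine lipConstOn_le_of_dist_le_mul (by positivity) fun z _ z' _ => ?_
    have h2 : |bellmanOp K π Q z - bellmanOp K π Q z'| ≤ L * (1 + Λ) * D * (LK * dist z z') := by
      refine (abs_bellmanOp_sub_le_mul_norm hΛ hπ (hK z) (hK z') hL hB hQL).trans ?_
      gcongr
      exact hKl z z'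
    rw [Real.dist_eq, hQ.bellman z, hQ.bellman z']
    calc _ = |(r z - r z') + γ * (bellmanOp K π Q z - bellmanOp K π Q z')| := by congr 1; ring
      _ ≤ |r z - r z'| + γ * |bellmanOp K π Q z - bellmanOp K π Q z'| := by
          refine (abs_add_le _ _).trans ?_
          rw [abs_mul, abs_of_nonneg hγ₀]
      _ ≤ Lr * dist z z' + γ * (L * (1 + Λ) * D * (LK * dist z z')) := by
          gcongr; exact hr z z'
      _ = _ := by ring
  refine (hQL z z').trans ?_
  gcongr
  rw [le_div_iff₀ (by linarith)]
  linarith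

/-- Banach's fixed point theorem for the sup norm on the `L`-Lipschitz functions. With `L = Lr / (1
- κ)`, the fixed point of `L ↦ Lr + κ * L`, this closed set is mapped into itself. -/
theorem exists_isQFunction {γ : ℝ} (hγ₀ : 0 ≤ γ) (hγ₁ : γ < 1) {r : S × A → ℝ}
    {K : S × A → SignedMeasure S} (hK : ∀ z, IsProbability (K z)) {Br Lr LK : ℝ} (hLr : 0 ≤ Lr)
    (hBr : ∀ z, |r z| ≤ Br) (hr : ∀ z z', |r z - r z'| ≤ Lr * dist z z')
    (hKl : ∀ z z', ‖K z - K z'‖ ≤ LK * dist z z')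
    (hκ : γ * (Metric.diam (univ : Set S) * LK * (1 + Λ)) < 1) :
    ∃ Q, IsQFunction γ r K π Q := by
  set D := Metric.diam (univ : Set S)
  have hD : 0 ≤ D := Metric.diam_nonneg
  set κ := γ * (D * LK * (1 + Λ)) with hκdef
  set L := Lr / (1 - κ) with hLdef
  have hL : 0 ≤ L := div_nonneg hLr (by linarith)
  have hLeq : Lr + κ * L = L := by
    rw [hLdef]; field_simp [show (1 - κ) ≠ 0 by linarith]; ring
  let P : Set (BoundedContinuousFunction (S × A) ℝ) :=
    {Q | ∀ z z', |Q z - Q z'| ≤ L * dist z z'}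
  have hPclosed : IsClosed P := by
    have hP : P = ⋂ z, ⋂ z', {Q : BoundedContinuousFunction (S × A) ℝ |
        |Q z - Q z'| ≤ L * dist z z'} := by
      ext Q; simp [P]
    rw [hP]
    refine isClosed_iInter fun z => isClosed_iInter fun z' => ?_
    exact isClosed_le (by fun_prop) continuous_const
  have hbd : ∀ Q : BoundedContinuousFunction (S × A) ℝ, ∀ z, |Q z| ≤ ‖Q‖ :=
    fun Q z => Q.norm_coe_le_norm z
  have hlip : ∀ Q ∈ P, ∀ z z', |(r z + γ * bellmanOp K π Q z) -
      (r z' + γ * bellmanOp K π Q z')| ≤ L * dist z z' := by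
    intro Q hQ z z'
    have h2 : |bellmanOp K π Q z - bellmanOp K π Q z'| ≤ L * (1 + Λ) * D * (LK * dist z z') := by
      refine (abs_bellmanOp_sub_le_mul_norm hΛ hπ (hK z) (hK z') hL (hbd Q) hQ).trans ?_
      gcongr
      exact hKl z z'
    calc _ = |(r z - r z') + γ * (bellmanOp K π Q z - bellmanOp K π Q z')| := by congr 1; ring
      _ ≤ |r z - r z'| + γ * |bellmanOp K π Q z - bellmanOp K π Q z'| := by
          refine (abs_add_le _ _).trans ?_
          rw [abs_mul, abs_of_nonneg hγ₀]
      _ ≤ Lr * dist z z' + γ * (L * (1 + Λ) * D * (LK * dist z z')) := by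
          gcongr; exact hr z z'
      _ = (Lr + κ * L) * dist z z' := by rw [hκdef]; ring
      _ = _ := by rw [hLeq]
  let Φ : P → P := fun Q =>
    ⟨BoundedContinuousFunction.ofNormedAddCommGroup
      (fun z => r z + γ * bellmanOp K π Q.1 z)
      (continuous_of_abs_sub_le_mul_dist (hlip Q.1 Q.2)) (Br + γ * ‖Q.1‖) (fun z => by
        refine (norm_add_le _ _).trans ?_
        rw [norm_mul, Real.norm_eq_abs γ, abs_of_nonneg hγ₀]
        gcongr
        · exact hBr z
        · exact abs_bellmanOp_le hK (hbd Q.1) z), hlip Q.1 Q.2⟩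
  have hΦ : ContractingWith γ.toNNReal Φ := by
    refine ⟨by simpa using hγ₁, LipschitzWith.of_dist_le_mul fun Q Q' => ?_⟩
    rw [Real.coe_toNNReal _ hγ₀, Subtype.dist_eq, Subtype.dist_eq]
    refine (BoundedContinuousFunction.dist_le (by positivity)).2 fun z => ?_
    have h := abs_bellmanOp_sub_le hΛ hπ hK hL hL (hbd Q.1) (hbd Q'.1) Q.2 Q'.2
      (N := dist Q.1 Q'.1) 
      (fun z => BoundedContinuousFunction.dist_coe_le_dist (f := Q.1) (g := Q'.1) z) z
    change |(r z + γ * bellmanOp K π Q.1 z) - (r z + γ * bellmanOp K π Q'.1 z)| ≤ _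
    rw [add_sub_add_left_eq_sub, ← mul_sub, abs_mul, abs_of_nonneg hγ₀]
    gcongr
  have : CompleteSpace P := hPclosed.completeSpace_coe
  have : Nonempty P := ⟨⟨0, fun z z' => by simpa using by positivity⟩⟩
  let Q := hΦ.fixedPoint Φ
  have hfix : Φ Q = Q := hΦ.fixedPoint_isFixedPt
  refine ⟨Q.1, ⟨‖Q.1‖, fun z _ => hbd Q.1 z⟩, ⟨L.toNNReal, ?_⟩, fun z => ?_⟩
  · refine LipschitzOnWith.of_dist_le_mul fun z _ z' _ => ?_
    rw [Real.coe_toNNReal _ hL]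
    exact Q.2 z z'
  · exact (congrArg (fun F : P => F.1 z) hfix).symm

theorem existsUnique_isQFunction {γ : ℝ} (hγ₀ : 0 ≤ γ) (hγ₁ : γ < 1) {r : S × A → ℝ}
    {K : S × A → SignedMeasure S} (hK : ∀ z, IsProbability (K z)) {Br Lr LK : ℝ} (hLr : 0 ≤ Lr)
    (hLK : 0 ≤ LK) (hBr : ∀ z, |r z| ≤ Br) (hr : ∀ z z', |r z - r z'| ≤ Lr * dist z z')
    (hKl : ∀ z z', ‖K z - K z'‖ ≤ LK * dist z z')
    (hκ : γ * (Metric.diam (univ : Set S) * LK * (1 + Λ)) < 1) :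
    ∃! Q, IsQFunction γ r K π Q := by
  obtain ⟨Q, hQ⟩ := exists_isQFunction hΛ hπ hγ₀ hγ₁ hK hLr hBr hr hKl hκ
  refine ⟨Q, hQ, fun Q' hQ' => funext fun z => ?_⟩
  have hL : 0 ≤ Lr / (1 - γ * (Metric.diam (univ : Set S) * LK * (1 + Λ))) :=
    div_nonneg hLr (by linarith)
  obtain ⟨B, hB⟩ := hQ.bounded
  obtain ⟨B', hB'⟩ := hQ'.bounded
  -- Uniqueness is stability with zero perturbation.
  have h := abs_sub_le_of_bellman hΛ hπ hγ₀ hγ₁ hK hK hL hL (fun z => hB' z (mem_univ z))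
    (fun z => hB z (mem_univ z))
    (IsQFunction.abs_sub_le hΛ hπ hγ₀ hK hLr hLK hr hKl hκ hQ')
    (IsQFunction.abs_sub_le hΛ hπ hγ₀ hK hLr hLK hr hKl hκ hQ) hQ'.bellman hQ.bellman
    (δ := 0) (ε := 0) (fun z => by simp) (fun z => by simp) z
  simp only [mul_zero, add_zero, zero_div] at h
  exact sub_eq_zero.1 (abs_nonpos_iff.1 h)

end LipschitzPolicy

end Bellman

/-! ### Linearization in the context. -/

section Linearization

/-- Quadratic remainder bound for the linearization of a function with bounded second
derivative on an open convex set. -/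
theorem norm_sub_sub_fderiv_le {E F : Type*} [NormedAddCommGroup E] [NormedSpace ℝ E]
    [NormedAddCommGroup F] [NormedSpace ℝ F] {C : Set E} (hCo : IsOpen C) (hCc : Convex ℝ C)
    {f : E → F} (hf : ContDiffOn ℝ 2 f C) {M : ℝ} (hM0 : 0 ≤ M)
    (hM : ∀ x ∈ C, ‖fderiv ℝ (fderiv ℝ f) x‖ ≤ M) {x y : E} (hx : x ∈ C) (hy : y ∈ C) :
    ‖f y - f x - fderiv ℝ f x (y - x)‖ ≤ M * ‖y - x‖ ^ 2 := by
  have hd : ∀ u ∈ C, DifferentiableAt ℝ f u := fun u hu =>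
    (hf.contDiffAt (hCo.mem_nhds hu)).differentiableAt (by norm_num)
  have hd2 : ∀ u ∈ C, DifferentiableAt ℝ (fderiv ℝ f) u := fun u hu =>
    ((hf.contDiffAt (hCo.mem_nhds hu)).fderiv_right (m := 1) (by norm_num)).differentiableAt
      (by norm_num)
  have hsub : segment ℝ x y ⊆ C := hCc.segment_subset hx hy
  -- Bounding the derivative increment uniformly on the segment, without integrating, gives `M`
  -- rather than `M / 2`; this is the constant in the final bound.
  have h1 : ∀ u ∈ segment ℝ x y, ‖fderiv ℝ f u - fderiv ℝ f x‖ ≤ M * ‖y - x‖ := fun u hu => by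
    refine (hCc.norm_image_sub_le_of_norm_fderiv_le hd2 hM hx (hsub hu)).trans ?_
    gcongr
    rw [← dist_eq_norm, ← dist_eq_norm, dist_comm u, dist_comm y]
    obtain ⟨a, b, ha, hb, hab, rfl⟩ := hu
    rw [dist_eq_norm, dist_eq_norm,
      show x - (a • x + b • y) = b • (x - y) by
        rw [show a = 1 - b by linarith, sub_smul, one_smul, smul_sub]; abel,
      norm_smul, Real.norm_of_nonneg hb]
    exact mul_le_of_le_one_left (norm_nonneg _) (by linarith)
  refine ((convex_segment x y).norm_image_sub_le_of_norm_fderiv_le'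
    (fun u hu => hd u (hsub hu)) h1 (left_mem_segment ℝ x y) (right_mem_segment ℝ x y)).trans_eq ?_
  ring

variable {S A E F : Type*} [NormedAddCommGroup E] [NormedSpace ℝ E]
    [NormedAddCommGroup F] [NormedSpace ℝ F] {C : Set E}

theorem norm_linearize_sub_slice_le (hCo : IsOpen C) (hCc : Convex ℝ C) {f : S × A × E → F}
    (hf : IsC2InContext f C) (hf₂ : IsBoundedOn (partialC (partialC f)) (dom S A C))
    {c₀ c : E} (hc₀ : c₀ ∈ C) (hc : c ∈ C) (z : S × A) :
    ‖linearize f c₀ c z - slice f c z‖ ≤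
      supNormOn (partialC (partialC f)) (dom S A C) * ‖c - c₀‖ ^ 2 := by
  have h := norm_sub_sub_fderiv_le hCo hCc (hf z.1 z.2)
    (supNormOn_nonneg (partialC (partialC f)) (dom S A C))
    (fun x hx => hf₂.norm_le_supNormOn (x := (z.1, z.2, x)) hx) hc₀ hc
  rw [norm_sub_rev]
  refine Eq.trans_le ?_ h
  rw [sub_sub]
  rfl

theorem norm_slice_sub_slice_le [MetricSpace S] [MetricSpace A] {f : S × A × E → F}
    (hf : IsLipschitzOn f (dom S A C)) {c : E} (hc : c ∈ C) (z z' : S × A) :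
    ‖slice f c z - slice f c z'‖ ≤ lipConstOn f (dom S A C) * dist z z' := by
  rw [← dist_eq_norm]
  refine (hf.dist_le_lipConstOn_mul (x := (z.1, z.2, c)) (y := (z'.1, z'.2, c)) hc hc).trans_eq ?_
  simp [Prod.dist_eq]

theorem norm_linearize_sub_linearize_le [MetricSpace S] [MetricSpace A] {f : S × A × E → F}
    (hf : IsLipschitzOn f (dom S A C)) (hf₁ : IsLipschitzOn (partialC f) (dom S A C))
    {c₀ : E} (hc₀ : c₀ ∈ C) (c : E) (z z' : S × A) :
    ‖linearize f c₀ c z - linearize f c₀ c z'‖ ≤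
      (lipConstOn f (dom S A C) + ‖c - c₀‖ * lipConstOn (partialC f) (dom S A C)) * dist z z' := by
  have h1 := norm_slice_sub_slice_le hf hc₀ z z'
  have h2 := norm_slice_sub_slice_le hf₁ hc₀ z z'
  have h3 := (slice (partialC f) c₀ z - slice (partialC f) c₀ z').le_opNorm (c - c₀)
  rw [show linearize f c₀ c z - linearize f c₀ c z' = (slice f c₀ z - slice f c₀ z') +
    (slice (partialC f) c₀ z - slice (partialC f) c₀ z') (c - c₀) by
      simp only [linearize, slice, _root_.sub_apply]; abel]
  refine (norm_add_le _ _).trans ?_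
  have h4 := mul_le_mul_of_nonneg_right h2 (norm_nonneg (c - c₀))
  linarith

theorem norm_linearize_le {f : S × A × E → F} (hf : IsBoundedOn f (dom S A C))
    (hf₁ : IsBoundedOn (partialC f) (dom S A C)) {c₀ : E} (hc₀ : c₀ ∈ C) (c : E) (z : S × A) :
    ‖linearize f c₀ c z‖ ≤
      supNormOn f (dom S A C) + supNormOn (partialC f) (dom S A C) * ‖c - c₀‖ := by
  have h1 := hf.norm_le_supNormOn (x := (z.1, z.2, c₀)) hc₀
  have h2 := hf₁.norm_le_supNormOn (x := (z.1, z.2, c₀)) hc₀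
  exact (norm_add_le _ _).trans
    (add_le_add h1 ((ContinuousLinearMap.le_opNorm _ _).trans (by gcongr)))

/-- Evaluation of signed measures at a set, as a continuous linear form. -/
noncomputable def applyCLM {X : Type*} [MeasurableSpace X] (i : Set X) :
    SignedMeasure X →L[ℝ] ℝ :=
  LinearMap.mkContinuous ⟨⟨fun μ => μ i, fun _ _ => rfl⟩, fun _ _ => rfl⟩ 1 fun μ => by
    rw [one_mul]; exact abs_apply_le_norm μ i

/-- Linearizing a family of measures of total mass one preserves the total mass. -/
theorem linearize_apply_univ [MeasurableSpace S] (hCo : IsOpen C)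
    {T : S × A × E → SignedMeasure S} (hT : ∀ z ∈ dom S A C, IsProbability (T z))
    (hTC2 : IsC2InContext T C) {c₀ : E} (hc₀ : c₀ ∈ C) (c : E) (z : S × A) :
    linearize T c₀ c z univ = 1 := by
  have hd : HasFDerivAt (fun x => T (z.1, z.2, x)) (partialC T (z.1, z.2, c₀)) c₀ :=
    (((hTC2 z.1 z.2).contDiffAt (hCo.mem_nhds hc₀)).differentiableAt (by norm_num)).hasFDerivAt
  have h1 := (applyCLM (univ : Set S)).hasFDerivAt.comp c₀ hd
  -- The total mass is constant near `c₀`, so uniqueness of derivatives forces the derivative of `T`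
  -- to take values of mass zero.
  have h2 : (fun x => applyCLM (univ : Set S) (T (z.1, z.2, x))) =ᶠ[nhds c₀] fun _ => 1 := by
    filter_upwards [hCo.mem_nhds hc₀] with x hx using (hT (z.1, z.2, x) hx).2
  have h3 := h1.unique ((hasFDerivAt_const (1 : ℝ) c₀).congr_of_eventuallyEq h2)
  have h4 : partialC T (z.1, z.2, c₀) (c - c₀) univ = 0 :=
    congrArg (fun φ : E →L[ℝ] ℝ => φ (c - c₀)) h3
  rw [linearize, _root_.add_apply, h4, (hT (z.1, z.2, c₀) hc₀).2, add_zero]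

end Linearization

/-- Turns the condition on `γ`, stated in `ℝ≥0∞` so that `1 / 0 = ∞`, into a real inequality that
also covers a vanishing denominator. -/
theorem mul_lt_one_of_ofReal_lt_one_div {x y : ℝ} (hx : 0 ≤ x) (hy : 0 ≤ y)
    (h : ENNReal.ofReal x < 1 / ENNReal.ofReal y) : x * y < 1 := by
  rcases hy.eq_or_lt with rfl | hy
  · simp
  · rw [ENNReal.lt_div_iff_mul_lt (Or.inl (by simpa using hy)) (Or.inl ENNReal.ofReal_ne_top),
      ← ENNReal.ofReal_mul hx, ← ENNReal.ofReal_one] at h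
    exact (ENNReal.ofReal_lt_ofReal_iff zero_lt_one).1 h

end CEBE

/-! ### The main theorem. -/

theorem theorem3
    {S A E : Type*}
    [MetricSpace S] [BoundedSpace S] [MeasurableSpace S] [BorelSpace S]
    [MetricSpace A] [MeasurableSpace A] [BorelSpace A]
    [NormedAddCommGroup E] [NormedSpace ℝ E] [CompleteSpace E]
    (C : Set E) (hCopen : IsOpen C) (hCconv : Convex ℝ C)
    (p : ℝ≥0∞) (hp : 1 ≤ p)
    -- transitions
    (T : S × A × E → SignedMeasure S)
    (hTprob : ∀ z ∈ CEBE.dom S A C, CEBE.IsProbability (T z))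
    (hTC2 : CEBE.IsC2InContext T C)
    (hTbdd₁ : CEBE.IsBoundedOn (CEBE.partialC T) (CEBE.dom S A C))
    (hTbdd₂ : CEBE.IsBoundedOn (CEBE.partialC (CEBE.partialC T)) (CEBE.dom S A C))
    (hTlip : CEBE.IsLipschitzOn T (CEBE.dom S A C))
    (hTlip₁ : CEBE.IsLipschitzOn (CEBE.partialC T) (CEBE.dom S A C))
    -- rewards
    (R : S × A × E → ℝ)
    (hRC2 : CEBE.IsC2InContext R C)
    (hRbdd : CEBE.IsBoundedOn R (CEBE.dom S A C))
    (hRbdd₁ : CEBE.IsBoundedOn (CEBE.partialC R) (CEBE.dom S A C))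
    (hRbdd₂ : CEBE.IsBoundedOn (CEBE.partialC (CEBE.partialC R)) (CEBE.dom S A C))
    (hRlip : CEBE.IsLipschitzOn R (CEBE.dom S A C))
    (hRlip₁ : CEBE.IsLipschitzOn (CEBE.partialC R) (CEBE.dom S A C))
    -- policy
    (π : S × E → ProbabilityMeasure A)
    (hπ : ∃ K : ℝ≥0, CEBE.PolicyLipschitzWith p C K π)
    -- contexts and discount factor
    (c₀ c : E) (hc₀ : c₀ ∈ C) (hc : c ∈ C)
    (hclose : ENNReal.ofReal ‖c - c₀‖ <
      ENNReal.ofReal (CEBE.supNormOn (CEBE.partialC (CEBE.partialC T)) (CEBE.dom S A C))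
        ^ (-(1 / 2) : ℝ))
    (γ : ℝ) (hγ₀ : 0 ≤ γ) (hγ₁ : γ < 1)
    (hγ : ENNReal.ofReal γ <
      1 / ENNReal.ofReal (4 * Metric.diam (univ : Set S) *
        (CEBE.lipConstOn T (CEBE.dom S A C) +
          ‖c - c₀‖ * CEBE.lipConstOn (CEBE.partialC T) (CEBE.dom S A C)) *
        (1 + CEBE.policyLipConst p C π))) :
    -- the projection to the simplex is well defined on the linearized transitions
    (∀ z, 0 < (CEBE.linearize T c₀ c z).toJordanDecomposition.posPart univ) ∧
    -- both Bellman equations have exactly one solution among the bounded Lipschitz functions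
    (∃! Q : S × A → ℝ,
      CEBE.IsQFunction γ (CEBE.slice R c) (CEBE.slice T c) (fun s => π (s, c)) Q) ∧
    (∃! Q : S × A → ℝ,
      CEBE.IsQFunction γ (CEBE.linearize R c₀ c)
        (fun z => CEBE.simplexProj (CEBE.linearize T c₀ c z)) (fun s => π (s, c)) Q) ∧
    -- the error bound
    ∀ Qbe Qce : S × A → ℝ,
      CEBE.IsQFunction γ (CEBE.slice R c) (CEBE.slice T c) (fun s => π (s, c)) Qbe →
      CEBE.IsQFunction γ (CEBE.linearize R c₀ c)
        (fun z => CEBE.simplexProj (CEBE.linearize T c₀ c z)) (fun s => π (s, c)) Qce →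
      CEBE.supNormOn (Qce - Qbe) univ ≤
        ‖c - c₀‖ ^ 2 / (1 - γ) *
          (CEBE.supNormOn (CEBE.partialC (CEBE.partialC R)) (CEBE.dom S A C) +
            3 * γ * Metric.diam (univ : Set S) * (1 + CEBE.policyLipConst p C π) *
              CEBE.lipNormOn R (CEBE.dom S A C) *
              CEBE.supNormOn (CEBE.partialC (CEBE.partialC T)) (CEBE.dom S A C) /
            (1 - γ * max 1 (Metric.diam (univ : Set S) *
              CEBE.lipConstOn T (CEBE.dom S A C) * (1 + CEBE.policyLipConst p C π)))) := by
  have hΛ := CEBE.wassersteinReal_one_le_policyLipConst_mul hp hπ hc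
  have hΛ0 : (0 : ℝ) ≤ CEBE.policyLipConst p C π := NNReal.coe_nonneg _
  have hLT0 : (0 : ℝ) ≤ CEBE.lipConstOn T (CEBE.dom S A C) := NNReal.coe_nonneg _
  have hLT₁0 : (0 : ℝ) ≤ CEBE.lipConstOn (CEBE.partialC T) (CEBE.dom S A C) := NNReal.coe_nonneg _
  have hLR0 : (0 : ℝ) ≤ CEBE.lipConstOn R (CEBE.dom S A C) := NNReal.coe_nonneg _
  have hLR₁0 : (0 : ℝ) ≤ CEBE.lipConstOn (CEBE.partialC R) (CEBE.dom S A C) := NNReal.coe_nonneg _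
  have hD0 : 0 ≤ Metric.diam (univ : Set S) := Metric.diam_nonneg
  have hM0 := CEBE.supNormOn_nonneg (CEBE.partialC (CEBE.partialC T)) (CEBE.dom S A C)
  have hMR0 := CEBE.supNormOn_nonneg (CEBE.partialC (CEBE.partialC R)) (CEBE.dom S A C)
  have hTmass := CEBE.linearize_apply_univ hCopen hTprob hTC2 hc₀ c
  have hTc : ∀ z, CEBE.IsProbability (CEBE.slice T c z) := fun z => hTprob (z.1, z.2, c) hc
  have hTce : ∀ z, CEBE.IsProbability (CEBE.simplexProj (CEBE.linearize T c₀ c z)) :=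
    fun z => CEBE.isProbability_simplexProj (hTmass z)
  have hTcl := CEBE.norm_slice_sub_slice_le hTlip hc
  have hTcel : ∀ z z', ‖CEBE.simplexProj (CEBE.linearize T c₀ c z) - CEBE.simplexProj (CEBE.linearize T c₀ c z')‖ ≤
      2 * (CEBE.lipConstOn T (CEBE.dom S A C) + ‖c - c₀‖ * CEBE.lipConstOn (CEBE.partialC T) (CEBE.dom S A C)) *
        dist z z' := fun z z' => by
    refine (CEBE.norm_simplexProj_sub_simplexProj_le (hTmass z) (hTmass z')).trans ?_
    rw [mul_assoc]
    gcongr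
    exact CEBE.norm_linearize_sub_linearize_le hTlip hTlip₁ hc₀ c z z'
  have hRcl := CEBE.norm_slice_sub_slice_le hRlip hc
  have hRcel := CEBE.norm_linearize_sub_linearize_le hRlip hRlip₁ hc₀ c
  have hRcb : ∀ z, |CEBE.slice R c z| ≤ CEBE.supNormOn R (CEBE.dom S A C) := fun z =>
    hRbdd.norm_le_supNormOn (x := (z.1, z.2, c)) hc
  have hRceb := CEBE.norm_linearize_le hRbdd hRbdd₁ hc₀ c
  have hγX := CEBE.mul_lt_one_of_ofReal_lt_one_div hγ₀ (by positivity) hγ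
  have hTerr : ∀ z, ‖CEBE.simplexProj (CEBE.linearize T c₀ c z) - CEBE.slice T c z‖ ≤
      3 * (CEBE.supNormOn (CEBE.partialC (CEBE.partialC T)) (CEBE.dom S A C) * ‖c - c₀‖ ^ 2) := fun z => by
    refine (CEBE.norm_simplexProj_sub_le (hTmass z) (hTc z).1).trans ?_
    gcongr
    exact CEBE.norm_linearize_sub_slice_le hCopen hCconv hTC2 hTbdd₂ hc₀ hc z
  have hRerr := CEBE.norm_linearize_sub_slice_le hCopen hCconv hRC2 hRbdd₂ hc₀ hc
  have hκ : γ * (Metric.diam (univ : Set S) * CEBE.lipConstOn T (CEBE.dom S A C) *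
      (1 + CEBE.policyLipConst p C π)) < 1 := by
    refine lt_of_le_of_lt (mul_le_mul_of_nonneg_left ?_ hγ₀) hγX
    gcongr
    · linarith
    · exact le_add_of_nonneg_right (by positivity)
  -- The projection doubles the Lipschitz constant of the linearized transitions; the 4 in the bound
  -- on `γ` absorbs this 2.
  have hκce : γ * (Metric.diam (univ : Set S) *
      (2 * (CEBE.lipConstOn T (CEBE.dom S A C) + ‖c - c₀‖ * CEBE.lipConstOn (CEBE.partialC T) (CEBE.dom S A C))) *
      (1 + CEBE.policyLipConst p C π)) < 1 := by
    refine lt_of_le_of_lt (mul_le_mul_of_nonneg_left ?_ hγ₀) hγX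
    rw [mul_left_comm, ← mul_assoc]
    gcongr
    norm_num
  have hκmax : γ * max 1 (Metric.diam (univ : Set S) * CEBE.lipConstOn T (CEBE.dom S A C) *
      (1 + CEBE.policyLipConst p C π)) < 1 := by
    rw [mul_max_of_nonneg _ _ hγ₀, mul_one]
    exact max_lt hγ₁ hκ
  have hRn0 : 0 ≤ CEBE.lipNormOn R (CEBE.dom S A C) := le_max_of_le_right hLR0
  refine ⟨fun z => ?_, ?_, ?_, fun Qbe Qce hbe hce => ?_⟩
  · have h := CEBE.one_le_posPart_real_univ (hTmass z)
    refine pos_iff_ne_zero.2 fun h0 => ?_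
    rw [measureReal_def, h0] at h
    norm_num at h
  · exact CEBE.existsUnique_isQFunction hΛ0 hΛ hγ₀ hγ₁ hTc hLR0 hLT0 hRcb hRcl hTcl hκ
  · exact CEBE.existsUnique_isQFunction hΛ0 hΛ hγ₀ hγ₁ hTce (by positivity) (by positivity) hRceb hRcel
      hTcel hκce
  · have hbel : ∀ z z', |Qbe z - Qbe z'| ≤ CEBE.lipNormOn R (CEBE.dom S A C) /
        (1 - γ * max 1 (Metric.diam (univ : Set S) * CEBE.lipConstOn T (CEBE.dom S A C) *
          (1 + CEBE.policyLipConst p C π))) * dist z z' := fun z z' => by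
      refine (CEBE.IsQFunction.abs_sub_le hΛ0 hΛ hγ₀ hTc hLR0 hLT0 hRcl hTcl hκ hbe z z').trans ?_
      have : 0 < 1 - γ * max 1 (Metric.diam (univ : Set S) * CEBE.lipConstOn T (CEBE.dom S A C) *
          (1 + CEBE.policyLipConst p C π)) := by linarith
      gcongr
      · exact le_max_right _ _
      · exact le_max_right _ _
    have hcel := CEBE.IsQFunction.abs_sub_le hΛ0 hΛ hγ₀ hTce (by positivity) (by positivity) hRcel
      hTcel hκce hce
    obtain ⟨B, hB⟩ := hbe.bounded
    obtain ⟨B', hB'⟩ := hce.bounded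
    -- `Qbe` takes the role of `Q'`, so the bound involves its Lipschitz constant, governed by `R`
    -- and `T`, and not that of `Qce`.
    have hdiff := CEBE.abs_sub_le_of_bellman hΛ0 hΛ hγ₀ hγ₁ hTce hTc
      (div_nonneg (by positivity) (by linarith)) (div_nonneg hRn0 (by linarith))
      (fun z => hB' z (mem_univ z)) (fun z => hB z (mem_univ z)) hcel hbel hce.bellman hbe.bellman
      hRerr hTerr
    have h1 : 0 < 1 - γ := by linarith
    have h2 : 0 < 1 - γ * max 1 (Metric.diam (univ : Set S) * CEBE.lipConstOn T (CEBE.dom S A C) *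
        (1 + CEBE.policyLipConst p C π)) := by linarith
    -- Nonnegativity of the bound is needed because the supremum over an empty `S × A` is 0.
    refine Real.iSup_le (fun z => (hdiff z).trans_eq ?_) (by positivity)
    field_simp
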